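/- Let $A,B,C$ be finite-dimensional quantum systems, where $A$ has dimension $d=|A|\ge 1$ and a fixed orthonormal basis $\{|x\rangle\}$. Put $|\Phi\rangle_{AA'}=\tfrac1{\sqrt d}\sum_x|x\rangle_A|x\rangle_{A'}$, $\Phi=|\Phi\rangle\langle\Phi|$. For a state (density operator) $\rho_{AB}$ and a quantum channel (completely positive trace-preserving map) $\mathcal E$ from $B$ to $A'\simeq A$, let $R(A|B)_{\rho,\mathcal E}=\mathrm{Tr}[\Phi_{AA'}\,(\mathrm{id}_A\otimes\mathcal E)(\rho_{AB})]$, and let $R_{\rm opt}(A|B)_\rho=\sup_{\mathcal E}R(A|B)_{\rho,\mathcal E}$ over all channels. When $B\simeq A$, let $R_{\rm U}(A|B)_\rho$ be the supremum of the same quantity over unitary channels $\mathcal E(M)=UMU^\dagger$ only. For a tripartite state, these quantities refer to its marginals $\rho_{AB}$ and $\rho_{AC}$. 1. (Bound.) For every tripartite state $\rho_{ABC}$, $$d^2R_{\rm opt}(A|C)_\rho\le\Big(\sqrt{R_{\rm opt}(A|B)_\rho}+\sqrt{d^2-1}\,\sqrt{1-R_{\rm opt}(A|B)_\rho}\Big)^2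 .\qquad(*)$$ 2. (Tightness.) Let $A\simeq B\simeq C$, let $|0\rangle$ be a vector of the fixed basis, and for real $\theta$ with $N=1+\sin(2\theta)/d>0$ let $$|\Psi_\theta\rangle_{ABC}=N^{-1/2}\big(\cos\theta\,|\Phi\rangle_{AB}|0\rangle_C+\sin\theta\,|\Phi\rangle_{AC}|0\rangle_B\big).$$ Then $\Psi_\theta$ is a state, and with the identity map $\mathcal I$ as recovery map $$R(A|B)_{\Psi_\theta,\mathcal I}=\frac{(d\cos\theta+\sin\theta)^2}{d(d+\sin2\theta)},\qquad R(A|C)_{\Psi_\theta,\mathcal I}=\frac{(d\sin\theta+\cos\theta)^2}{d(d+\sin2\theta)} .$$ For every $\theta\in[0,\pi/2]$ one has $N>0$, the identity is an optimal recovery map for both $B$ and $C$, i.e. $R_{\rm opt}(A|B)_{\Psi_\theta}=R(A|B)_{\Psi_\theta,\mathcal I}$ and $R_{\rm opt}(A|C)_{\Psi_\theta}=R(A|C)_{\Psi_\theta,\mathcal I}$, and $(*)$ holds with equality for $\Psi_\theta$. For every finite-dimensional $B$ and every state $\sigma_{AB}$ one has $1/d^2\le R_{\rm opt}(A|B)_\sigma\le1$,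 and every value $r\in[1/d^2,1]$ is equal to $R_{\rm opt}(A|B)_{\Psi_\theta}$ for some $\theta\in[0,\pi/2]$; so equality in $(*)$ is attained at every possible value of $R_{\rm opt}(A|B)$. 3. (Singlet monogamy for three systems, i.e. optimality of $\Psi_\theta$ under unitary recovery.) Let $A\simeq B\simeq C$. For every state $\rho_{ABC}$, the numbers $x=R_{\rm U}(A|B)_\rho$ and $z=R_{\rm U}(A|C)_\rho$ satisfy $$d^2z\le\big(\sqrt x+\sqrt{d^2-1}\sqrt{1-x}\big)^2\quad\text{and}\quad x+z\le\frac{d-1}d+\frac{(\sqrt x+\sqrt z)^2}{d+1},$$ and there is $\theta\in[0,\pi/2]$, which does not depend on the choice of the basis vector $|0\rangle$, such that $x\le R_{\rm U}(A|B)_{\Psi_\theta}$ and $z\le R_{\rm U}(A|C)_{\Psi_\theta}$. Moreover $R_{\rm U}(A|B)_{\Psi_\theta}=R_{\rm opt}(A|B)_{\Psi_\theta}$ and $R_{\rm U}(A|C)_{\Psi_\theta}=R_{\rm opt}(A|C)_{\Psi_\theta}$ for all $\theta\in[0,\pi/2]$. -/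

import Mathlib

open scoped Matrix ComplexOrder

noncomputable section

namespace Monogamy

/-- A density operator on the finite-dimensional system `ℂ^S` with orthonormal basis `S`. -/
def IsState {S : Type*} [Fintype S] (ρ : Matrix S S ℂ) : Prop :=
  ρ.PosSemidef ∧ ρ.trace = 1

/-- The rank-one operator `|ψ⟩⟨ψ|`. -/
def ketbra {S : Type*} (ψ : S → ℂ) : Matrix S S ℂ :=
  Matrix.vecMulVec ψ (star ψ)

/-- The marginal `ρ_AB = Tr_C ρ_ABC`. -/
def marginalAB {A B C : Type*} [Fintype C]
    (ρ : Matrix (A × B × C) (A × B × C) ℂ) : Matrix (A × B) (A × B) ℂ :=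
  fun p q => ∑ c, ρ (p.1, p.2, c) (q.1, q.2, c)

/-- The marginal `ρ_AC = Tr_B ρ_ABC`. -/
def marginalAC {A B C : Type*} [Fintype B]
    (ρ : Matrix (A × B × C) (A × B × C) ℂ) : Matrix (A × C) (A × C) ℂ :=
  fun p q => ∑ b, ρ (p.1, b, p.2) (q.1, b, q.2)

/-- `(id_R ⊗ E)(M)`: the map `E` acts on every `B`-block of the operator `M` on `R ⊗ B`. -/
def idTensor {B D : Type*} (R : Type*) (E : Matrix B B ℂ →ₗ[ℂ] Matrix D D ℂ)
    (M : Matrix (R × B) (R × B) ℂ) : Matrix (R × D) (R × D) ℂ :=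
  fun p q => E (fun b b' => M (p.1, b) (q.1, b')) p.2 q.2

/-- A quantum channel from `B` to `D`: a completely positive trace-preserving linear map. -/
structure IsChannel {B D : Type*} [Fintype B] [Fintype D]
    (E : Matrix B B ℂ →ₗ[ℂ] Matrix D D ℂ) : Prop where
  completelyPositive : ∀ (n : ℕ) (M : Matrix (Fin n × B) (Fin n × B) ℂ),
    M.PosSemidef → (idTensor (Fin n) E M).PosSemidef
  tracePreserving : ∀ M : Matrix B B ℂ, (E M).trace = M.trace

/-- The maximally entangled vector `|A|^{-1/2} ∑ₓ |x⟩|x⟩` of `A ⊗ A'` with `A' ≃ A`. -/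
def maxEntangled (A : Type*) [Fintype A] [DecidableEq A] : A × A → ℂ :=
  fun p => if p.1 = p.2 then ((1 / √(Fintype.card A : ℝ) : ℝ) : ℂ) else 0

/-- The fidelity `R(A|B)_{ρ,E} = Tr[Φ_{AA'} E_{A'|B}(ρ_AB)]` (a real number for states `ρ` and
channels `E`). -/
def recoveryFidelity {A B : Type*} [Fintype A] [DecidableEq A]
    (ρ : Matrix (A × B) (A × B) ℂ) (E : Matrix B B ℂ →ₗ[ℂ] Matrix A A ℂ) : ℝ :=
  (Matrix.trace (ketbra (maxEntangled A) * idTensor A E ρ)).re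

/-- The optimal fidelity `R_opt(A|B)_ρ`, over all channels from `B` to `A' ≃ A`. -/
def Ropt {A B : Type*} [Fintype A] [DecidableEq A] [Fintype B]
    (ρ : Matrix (A × B) (A × B) ℂ) : ℝ :=
  sSup {r : ℝ | ∃ E : Matrix B B ℂ →ₗ[ℂ] Matrix A A ℂ, IsChannel E ∧ r = recoveryFidelity ρ E}

/-- Conjugation `M ↦ U M U†`. -/
def conjMap {A : Type*} [Fintype A] (U : Matrix A A ℂ) : Matrix A A ℂ →ₗ[ℂ] Matrix A A ℂ where
  toFun M := U * M * Uᴴ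
  map_add' M N := by rw [mul_add, add_mul]
  map_smul' c M := by simp

/-- The optimal fidelity when `B ≃ A` and the recovery operation is restricted to be unitary. -/
def Runitary {A : Type*} [Fintype A] [DecidableEq A] (ρ : Matrix (A × A) (A × A) ℂ) : ℝ :=
  sSup {r : ℝ | ∃ U ∈ Matrix.unitaryGroup A ℂ, r = recoveryFidelity ρ (conjMap U)}

/-- The normalization constant `N = 1 + sin(2θ) / |A|`. -/
def superpositionNorm (A : Type*) [Fintype A] (θ : ℝ) : ℝ :=
  1 + Real.sin (2 * θ) / (Fintype.card A : ℝ)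

/-- The vector `N^{-1/2} (cos θ |Φ⟩_AB |o⟩_C + sin θ |Φ⟩_AC |o⟩_B)` of `A ⊗ B ⊗ C` with
`A ≃ B ≃ C`, where `|o⟩` is a vector of the basis in which `Φ` is written. -/
def superposition {A : Type*} [Fintype A] [DecidableEq A] (o : A) (θ : ℝ) : A × A × A → ℂ :=
  fun p => ((1 / √(superpositionNorm A θ) : ℝ) : ℂ) *
    ((Real.cos θ : ℂ) * (maxEntangled A (p.1, p.2.1) * if p.2.2 = o then 1 else 0) +
      (Real.sin θ : ℂ) * (maxEntangled A (p.1, p.2.2) * if p.2.1 = o then 1 else 0))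

/-- The density operator of the superposition state. -/
def superpositionState {A : Type*} [Fintype A] [DecidableEq A] (o : A) (θ : ℝ) :
    Matrix (A × A × A) (A × A × A) ℂ :=
  ketbra (superposition o θ)

end Monogamy

end

/-! Everything follows from one inequality: with `c = 1/d`, the fidelities `x` for `B` and `z` for
`C` satisfy `x + z - 2c√x√z ≤ 1 - c²`, so `(√x, √z)` lies in an ellipse. For trivial recovery,
purify the state to a unit vector `ψ`. The maps `S = Φ_AB ⊗ ·` and `T = Φ_AC ⊗ ·` are isometries
with `S†T = c`, and the fidelities are `‖S†ψ‖²` and `‖T†ψ‖²`; Cauchy-Schwarz (`norm_sub_smul_sq_le`)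
and the reverse triangle inequality give the ellipse (`recoveryFidelity_id_ellipse`). General
channels reduce to this case because applying them locally yields another state on `A ⊗ A ⊗ A`. The
suprema inherit the inequality because it defines a closed region (`ellipse_csSup`). Solving it for
`z` gives the bound. For tightness, the identity fidelities of `Ψ_θ` trace the arc of the ellipse on
which both coordinates of the outward normal are nonnegative. No other admissible pair dominates
such a point (`eq_superpositionFidelity_of_ellipse`), so trivial recovery is optimal on both sides
at once. Unitary recovery lies between trivial and optimal recovery. -/

noncomputable section

namespace Monogamy

/-! ### Channels acting locally on bipartite and tripartite operators. -/

section Channels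

variable {A B C D D' R : Type*}

theorem idTensor_apply (E : Matrix B B ℂ →ₗ[ℂ] Matrix D D ℂ) (M : Matrix (R × B) (R × B) ℂ)
    (p q : R × D) :
    idTensor R E M p q = E (M.submatrix (Prod.mk p.1) (Prod.mk q.1)) p.2 q.2 := rfl

/-- Complete positivity is tested only on the references `Fin n`; relabelling the basis transfers it
to any finite reference, in particular to products of other subsystems. -/
theorem IsChannel.posSemidef_idTensor [Fintype B] [Fintype D] [Fintype R]
    {E : Matrix B B ℂ →ₗ[ℂ] Matrix D D ℂ} (hE : IsChannel E)
    {M : Matrix (R × B) (R × B) ℂ} (hM : M.PosSemidef) : (idTensor R E M).PosSemidef := by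
  let e := Fintype.equivFin R
  have h := hE.completelyPositive _ (M.submatrix (Prod.map e.symm id) (Prod.map e.symm id))
    (hM.submatrix _)
  have h' := h.submatrix (Prod.map e id)
  convert h' using 1
  ext p q
  simp [idTensor]

theorem IsChannel.isState_idTensor [Fintype B] [Fintype D] [Fintype R]
    {E : Matrix B B ℂ →ₗ[ℂ] Matrix D D ℂ} (hE : IsChannel E)
    {M : Matrix (R × B) (R × B) ℂ} (hM : IsState M) : IsState (idTensor R E M) := by
  refine ⟨hE.posSemidef_idTensor hM.1, ?_⟩
  rw [← hM.2, Matrix.trace, Matrix.trace, Fintype.sum_prod_type, Fintype.sum_prod_type]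
  exact Finset.sum_congr rfl fun r _ => hE.tracePreserving fun b b' => M (r, b) (r, b')

/-- Conjugation by a unitary is a channel. -/
theorem isChannel_conjMap [Fintype A] [DecidableEq A] {U : Matrix A A ℂ}
    (hU : U ∈ Matrix.unitaryGroup A ℂ) : IsChannel (conjMap U) := by
  refine ⟨fun n M hM => ?_, fun M => ?_⟩
  · have h := hM.mul_mul_conjTranspose_same
      (Matrix.kroneckerMap (· * ·) (1 : Matrix (Fin n) (Fin n) ℂ) U)
    have e : idTensor (Fin n) (conjMap U) M = Matrix.kroneckerMap (· * ·) 1 U * M *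
        (Matrix.kroneckerMap (· * ·) (1 : Matrix (Fin n) (Fin n) ℂ) U)ᴴ := by
      ext p q
      rw [idTensor_apply]
      simp only [conjMap, LinearMap.coe_mk, AddHom.coe_mk, Matrix.mul_apply,
        Matrix.conjTranspose_apply, Matrix.kroneckerMap_apply, Fintype.sum_prod_type,
        Matrix.one_apply, ite_mul, mul_ite, one_mul, zero_mul, mul_zero,
        Finset.sum_ite_irrel, Finset.sum_const_zero, Finset.sum_ite_eq, Finset.mem_univ, if_true,
        apply_ite star, star_zero, Matrix.submatrix_apply]
    rw [e]
    exact h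
  · change (U * M * Uᴴ).trace = M.trace
    rw [Matrix.trace_mul_comm, ← Matrix.mul_assoc,
      show Uᴴ * U = 1 from Matrix.mem_unitaryGroup_iff'.1 hU, Matrix.one_mul]

theorem conjMap_one [Fintype A] [DecidableEq A] :
    conjMap (1 : Matrix A A ℂ) = LinearMap.id := by
  ext M : 1
  simp [conjMap]

/-- The channel that discards its input and prepares the maximally mixed state. -/
def depolarize (B A : Type*) [Fintype B] [Fintype A] [DecidableEq A] :
    Matrix B B ℂ →ₗ[ℂ] Matrix A A ℂ :=
  (Matrix.traceLinearMap B ℂ ℂ).smulRight ((Fintype.card A : ℂ)⁻¹ • (1 : Matrix A A ℂ))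

theorem depolarize_apply [Fintype B] [Fintype A] [DecidableEq A] (M : Matrix B B ℂ) :
    depolarize B A M = M.trace • (Fintype.card A : ℂ)⁻¹ • (1 : Matrix A A ℂ) := rfl

theorem isChannel_depolarize [Fintype B] [Fintype A] [DecidableEq A] [Nonempty A] :
    IsChannel (depolarize B A) := by
  refine ⟨fun n M hM => ?_, fun M => ?_⟩
  -- The output is the Kronecker product of the partial trace `Tr_B M` with `1/d`, both positive
  -- semidefinite.
  · have h : (∑ b, M.submatrix (fun i : Fin n => (i, b)) (fun i => (i, b))).PosSemidef :=
      Matrix.posSemidef_sum _ fun b _ => hM.submatrix _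
    have h2 : ((Fintype.card A : ℂ)⁻¹ • (1 : Matrix A A ℂ)).PosSemidef :=
      Matrix.PosSemidef.one.smul (by positivity)
    have e : idTensor (Fin n) (depolarize B A) M = Matrix.kroneckerMap (· * ·)
        (∑ b, M.submatrix (fun i : Fin n => (i, b)) (fun i => (i, b)))
        ((Fintype.card A : ℂ)⁻¹ • (1 : Matrix A A ℂ)) := by
      ext p q
      simp [idTensor_apply, depolarize_apply, Matrix.trace, Matrix.sum_apply]
    rw [e]
    exact h.kronecker h2
  · have : (Fintype.card A : ℂ) ≠ 0 := by simp
    simp [depolarize_apply, this]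

/-- The operator `(id_A ⊗ F ⊗ E)(ρ_ABC)`. -/
def localChannels (F : Matrix B B ℂ →ₗ[ℂ] Matrix D D ℂ) (E : Matrix C C ℂ →ₗ[ℂ] Matrix D' D' ℂ)
    (ρ : Matrix (A × B × C) (A × B × C) ℂ) : Matrix (A × D × D') (A × D × D') ℂ :=
  fun p q => E (fun c c' => F (fun b b' => ρ (p.1, b, c) (q.1, b', c')) p.2.1 q.2.1) p.2.2 q.2.2

variable {F : Matrix B B ℂ →ₗ[ℂ] Matrix D D ℂ} {E : Matrix C C ℂ →ₗ[ℂ] Matrix D' D' ℂ}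

theorem posSemidef_localChannels [Fintype A] [Fintype B] [Fintype C] [Fintype D] [Fintype D']
    (hF : IsChannel F) (hE : IsChannel E)
    {ρ : Matrix (A × B × C) (A × B × C) ℂ} (hρ : ρ.PosSemidef) :
    (localChannels F E ρ).PosSemidef := by
  -- The tensor factors are regrouped so that each channel in turn acts last, with the other systems
  -- as reference.
  have h1 := hF.posSemidef_idTensor (R := A × C)
    (hρ.submatrix fun p : (A × C) × B => (p.1.1, p.2, p.1.2))
  have h2 := hE.posSemidef_idTensor (R := A × D)
    (h1.submatrix fun p : (A × D) × C => ((p.1.1, p.2), p.1.2))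
  exact h2.submatrix fun p : A × D × D' => ((p.1, p.2.1), p.2.2)

/-- No signalling: trace preservation makes the channel on `C` invisible once `C` is traced out. -/
theorem marginalAB_localChannels [Fintype C] [Fintype D'] (hE : IsChannel E) (ρ : Matrix (A × B × C) (A × B × C) ℂ) :
    marginalAB (localChannels F E ρ) = idTensor A F (marginalAB ρ) := by
  ext p q
  have h2 : (marginalAB ρ).submatrix (Prod.mk p.1) (Prod.mk q.1) =
      ∑ c, ρ.submatrix (fun b => (p.1, b, c)) (fun b => (q.1, b, c)) := by
    ext b b'
    simp [marginalAB, Matrix.sum_apply]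
  rw [idTensor_apply, h2, map_sum, Matrix.sum_apply]
  exact hE.tracePreserving (Matrix.of fun c c' =>
    F (fun b b' => ρ (p.1, b, c) (q.1, b', c')) p.2 q.2)

theorem marginalAC_localChannels [Fintype B] [Fintype D] (hF : IsChannel F) (ρ : Matrix (A × B × C) (A × B × C) ℂ) :
    marginalAC (localChannels F E ρ) = idTensor A E (marginalAC ρ) := by
  ext p q
  have h2 : (marginalAC ρ).submatrix (Prod.mk p.1) (Prod.mk q.1) =
      ∑ x, Matrix.of fun c c' => F (fun b b' => ρ (p.1, b, c) (q.1, b', c')) x x := by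
    ext c c'
    rw [Matrix.sum_apply]
    exact (hF.tracePreserving fun b b' => ρ (p.1, b, c) (q.1, b', c')).symm
  rw [idTensor_apply, h2, map_sum, Matrix.sum_apply]
  rfl

theorem trace_marginalAB [Fintype A] [Fintype B] [Fintype C]
    (ρ : Matrix (A × B × C) (A × B × C) ℂ) :
    (marginalAB ρ).trace = ρ.trace := by
  simp [Matrix.trace, marginalAB, Fintype.sum_prod_type]

theorem trace_marginalAC [Fintype A] [Fintype B] [Fintype C]
    (ρ : Matrix (A × B × C) (A × B × C) ℂ) :
    (marginalAC ρ).trace = ρ.trace := by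
  simp only [Matrix.trace, marginalAC, Fintype.sum_prod_type, Matrix.diag_apply]
  exact Finset.sum_congr rfl fun a _ => Finset.sum_comm

theorem IsState.marginalAB [Fintype A] [Fintype B] [Fintype C]
    {ρ : Matrix (A × B × C) (A × B × C) ℂ} (hρ : IsState ρ) :
    IsState (marginalAB ρ) := by
  refine ⟨?_, (trace_marginalAB ρ).trans hρ.2⟩
  convert Matrix.posSemidef_sum Finset.univ fun (c : C) _ =>
    hρ.1.submatrix (fun p : A × B => (p.1, p.2, c)) using 1
  ext p q
  simp [Monogamy.marginalAB, Matrix.sum_apply]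

theorem IsState.marginalAC [Fintype A] [Fintype B] [Fintype C]
    {ρ : Matrix (A × B × C) (A × B × C) ℂ} (hρ : IsState ρ) :
    IsState (marginalAC ρ) := by
  refine ⟨?_, (trace_marginalAC ρ).trans hρ.2⟩
  convert Matrix.posSemidef_sum Finset.univ fun (b : B) _ =>
    hρ.1.submatrix (fun p : A × C => (p.1, b, p.2)) using 1
  ext p q
  simp [Monogamy.marginalAC, Matrix.sum_apply]

theorem isState_localChannels [Fintype A] [Fintype B] [Fintype C] [Fintype D] [Fintype D']
    (hF : IsChannel F) (hE : IsChannel E)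
    {ρ : Matrix (A × B × C) (A × B × C) ℂ} (hρ : IsState ρ) : IsState (localChannels F E ρ) := by
  refine ⟨posSemidef_localChannels hF hE hρ.1, ?_⟩
  rw [← trace_marginalAB, marginalAB_localChannels hE]
  exact (hF.isState_idTensor hρ.marginalAB).2

end Channels

/-! ### Two isometries with a scalar overlap. -/

section Geometry

open scoped InnerProductSpace

variable {H V : Type*} [NormedAddCommGroup H] [InnerProductSpace ℂ H]
  [NormedAddCommGroup V] [InnerProductSpace ℂ V]

/-- If `S` and `T` are isometries with `S† T = c`, and `u = S† ψ`, `v = T† ψ`, then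
`‖v - c u‖² ≤ (1 - c²) (‖ψ‖² - ‖u‖²)`. -/
theorem norm_sub_smul_sq_le {S T : V → H} {c : ℝ} (hc : c ^ 2 ≤ 1)
    (hS : ∀ v w, ⟪S v, S w⟫_ℂ = ⟪v, w⟫_ℂ) (hT : ∀ v w, ⟪T v, T w⟫_ℂ = ⟪v, w⟫_ℂ)
    (hST : ∀ v w, ⟪S v, T w⟫_ℂ = c * ⟪v, w⟫_ℂ) {ψ : H} {u v : V}
    (hu : ∀ w, ⟪S w, ψ⟫_ℂ = ⟪w, u⟫_ℂ) (hv : ∀ w, ⟪T w, ψ⟫_ℂ = ⟪w, v⟫_ℂ) :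
    ‖v - (c : ℂ) • u‖ ^ 2 ≤ (1 - c ^ 2) * (‖ψ‖ ^ 2 - ‖u‖ ^ 2) := by
  set e := v - (c : ℂ) • u with he
  have hTS : ∀ v w, ⟪T v, S w⟫_ℂ = c * ⟪v, w⟫_ℂ := fun v w => by
    rw [← inner_conj_symm, hST, map_mul, inner_conj_symm, Complex.conj_ofReal]
  have hψS : ∀ w, ⟪ψ, S w⟫_ℂ = ⟪u, w⟫_ℂ := fun w => by
    rw [← inner_conj_symm, hu, inner_conj_symm]
  -- The residual `ψ - S u` is orthogonal to the range of `S`, and `T†` sends it to `v - c u = e`.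
  -- Cauchy-Schwarz on this pairing bounds `‖e‖²`.
  have h1 : ⟪T e - (c : ℂ) • S e, ψ - S u⟫_ℂ = ⟪e, e⟫_ℂ := by
    simp only [inner_sub_left, inner_sub_right, inner_smul_left, hv, hu, hTS, hS]
    conv_rhs => rw [he, inner_sub_right, inner_smul_right, ← he]
    simp only [Complex.conj_ofReal]
    ring
  have h2 : ‖T e - (c : ℂ) • S e‖ ^ 2 = (1 - c ^ 2) * ‖e‖ ^ 2 := by
    have : (((‖T e - (c : ℂ) • S e‖ ^ 2 : ℝ)) : ℂ) = (((1 - c ^ 2) * ‖e‖ ^ 2 : ℝ) : ℂ) := by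
      push_cast
      simp only [← RCLike.ofReal_eq_complex_ofReal, ← inner_self_eq_norm_sq_to_K]
      simp only [inner_sub_left, inner_sub_right, inner_smul_left, inner_smul_right, hTS, hS, hT,
        hST, Complex.conj_ofReal, RCLike.ofReal_eq_complex_ofReal]
      ring
    exact_mod_cast this
  have h3 : ‖ψ - S u‖ ^ 2 = ‖ψ‖ ^ 2 - ‖u‖ ^ 2 := by
    have : (((‖ψ - S u‖ ^ 2 : ℝ)) : ℂ) = ((‖ψ‖ ^ 2 - ‖u‖ ^ 2 : ℝ) : ℂ) := by
      push_cast
      simp only [← RCLike.ofReal_eq_complex_ofReal, ← inner_self_eq_norm_sq_to_K]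
      simp only [inner_sub_left, inner_sub_right, hu, hψS, hS]
      ring
    exact_mod_cast this
  have h4 : ‖e‖ ^ 2 ≤ ‖T e - (c : ℂ) • S e‖ * ‖ψ - S u‖ := by
    have := norm_inner_le_norm (𝕜 := ℂ) (T e - (c : ℂ) • S e) (ψ - S u)
    rw [h1, inner_self_eq_norm_sq_to_K] at this
    simpa using this
  rcases (norm_nonneg e).eq_or_lt with h0 | h0
  · rw [← h0, ← h3]
    -- With `e = 0` nothing can be cancelled; the right side is a product of nonnegative factors.
    nlinarith [sq_nonneg ‖ψ - S u‖]
  · have h5 : (‖e‖ ^ 2) ^ 2 ≤ (1 - c ^ 2) * ‖e‖ ^ 2 * (‖ψ‖ ^ 2 - ‖u‖ ^ 2) := by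
      rw [← h2, ← h3, ← mul_pow]
      exact pow_le_pow_left₀ (by positivity) h4 2
    have h6 : 0 < ‖e‖ ^ 2 := by positivity
    nlinarith

end Geometry

/-! ### Recovery fidelity as a squared overlap, and the ellipse for trivial recovery. -/

section Fidelity

variable {A B C : Type*} [Fintype A] [DecidableEq A]

theorem recoveryFidelity_eq (ρ : Matrix (A × B) (A × B) ℂ)
    (E : Matrix B B ℂ →ₗ[ℂ] Matrix A A ℂ) :
    recoveryFidelity ρ E =
      (∑ a, ∑ a', idTensor A E ρ (a, a) (a', a')).re / Fintype.card A := by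
  have h : Matrix.trace (ketbra (maxEntangled A) * idTensor A E ρ) =
      ((1 / (Fintype.card A : ℝ) : ℝ) : ℂ) * ∑ a, ∑ a', idTensor A E ρ (a, a) (a', a') := by
    have hd : (1 / √(Fintype.card A : ℝ)) * (1 / √(Fintype.card A : ℝ)) =
        1 / (Fintype.card A : ℝ) := by
      rw [div_mul_div_comm, one_mul, Real.mul_self_sqrt (Nat.cast_nonneg _)]
    simp only [Matrix.trace, Matrix.diag_apply, Matrix.mul_apply, ketbra, Matrix.vecMulVec_apply,
      maxEntangled, Fintype.sum_prod_type, Pi.star_apply, apply_ite star, star_zero, ite_mul,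
      mul_ite, zero_mul, mul_zero, Finset.sum_ite_eq, Finset.mem_univ, if_true,
      Finset.sum_const_zero, Finset.sum_ite_irrel]
    rw [Finset.sum_comm, Finset.mul_sum]
    refine Finset.sum_congr rfl fun a _ => ?_
    rw [Finset.mul_sum]
    refine Finset.sum_congr rfl fun a' _ => ?_
    rw [← hd]
    simp
  rw [recoveryFidelity, h, Complex.re_ofReal_mul]
  ring

theorem recoveryFidelity_idTensor (ρ : Matrix (A × B) (A × B) ℂ)
    (E : Matrix B B ℂ →ₗ[ℂ] Matrix A A ℂ) :
    recoveryFidelity (idTensor A E ρ) LinearMap.id = recoveryFidelity ρ E := rfl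

theorem recoveryFidelity_id (σ : Matrix (A × A) (A × A) ℂ) :
    recoveryFidelity σ LinearMap.id =
      (∑ a, ∑ a', σ (a, a) (a', a')).re / Fintype.card A :=
  recoveryFidelity_eq σ _

theorem re_sum_sum_mul_star {ι : Type*} [Fintype ι] (f : ι → ℂ) :
    (∑ i, ∑ j, f i * star (f j)).re = ‖∑ i, f i‖ ^ 2 := by
  have : ∑ i, ∑ j, f i * star (f j) = ((‖∑ i, f i‖ ^ 2 : ℝ) : ℂ) := by
    rw [← Finset.sum_mul_sum, ← star_sum]
    push_cast
    exact Complex.mul_conj' _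
  rw [this, Complex.ofReal_re]

open scoped MatrixOrder Matrix.Norms.L2Operator in
/-- Every positive semidefinite operator is a sum of rank-one operators. -/
theorem exists_sum_of_posSemidef {S : Type*} [Fintype S] {ρ : Matrix S S ℂ}
    (hρ : ρ.PosSemidef) : ∃ ψ : S → S → ℂ, ∀ i j, ρ i j = ∑ k, ψ k i * star (ψ k j) := by
  classical
  obtain ⟨B, rfl⟩ := CStarAlgebra.nonneg_iff_eq_star_mul_self.mp hρ.nonneg
  exact ⟨fun k i => star (B k i), fun i j => by simp [Matrix.mul_apply, Matrix.star_apply]⟩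

theorem trace_re_of_sum {S K : Type*} [Fintype S] [Fintype K] {ρ : Matrix S S ℂ}
    {ψ : K → S → ℂ} (h : ∀ i j, ρ i j = ∑ k, ψ k i * star (ψ k j)) :
    ρ.trace.re = ∑ k, ∑ i, ‖ψ k i‖ ^ 2 := by
  rw [Finset.sum_comm, Matrix.trace, Complex.re_sum]
  refine Finset.sum_congr rfl fun i _ => ?_
  rw [Matrix.diag_apply, h, Complex.re_sum]
  refine Finset.sum_congr rfl fun k _ => ?_
  rw [show ψ k i * star (ψ k i) = ((‖ψ k i‖ ^ 2 : ℝ) : ℂ) by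
    push_cast; exact Complex.mul_conj' _, Complex.ofReal_re]

theorem recoveryFidelity_id_of_sum {K : Type*} [Fintype K] {σ : Matrix (A × A) (A × A) ℂ}
    {ψ : K → A × A → ℂ} (h : ∀ i j, σ i j = ∑ k, ψ k i * star (ψ k j)) :
    recoveryFidelity σ LinearMap.id = (∑ k, ‖∑ a, ψ k (a, a)‖ ^ 2) / Fintype.card A := by
  rw [recoveryFidelity_id]
  congr 1
  simp only [h, ← re_sum_sum_mul_star, ← Complex.re_sum]
  congr 1
  refine (Finset.sum_congr rfl fun a _ => Finset.sum_comm).trans ?_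
  exact Finset.sum_comm

theorem recoveryFidelity_id_nonneg {σ : Matrix (A × A) (A × A) ℂ} (hσ : IsState σ) :
    0 ≤ recoveryFidelity σ LinearMap.id := by
  obtain ⟨ψ, h⟩ := exists_sum_of_posSemidef hσ.1
  rw [recoveryFidelity_id_of_sum h]
  positivity

theorem recoveryFidelity_id_le_one {σ : Matrix (A × A) (A × A) ℂ} (hσ : IsState σ) :
    recoveryFidelity σ LinearMap.id ≤ 1 := by
  obtain ⟨ψ, h⟩ := exists_sum_of_posSemidef hσ.1
  rw [recoveryFidelity_id_of_sum h]
  have h1 := trace_re_of_sum h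
  rw [hσ.2, Complex.one_re] at h1
  refine div_le_of_le_mul₀ (Nat.cast_nonneg _) zero_le_one ?_
  rw [h1, Finset.sum_mul]
  refine Finset.sum_le_sum fun k _ => ?_
  calc ‖∑ a, ψ k (a, a)‖ ^ 2 ≤ (∑ a, ‖ψ k (a, a)‖) ^ 2 :=
        pow_le_pow_left₀ (norm_nonneg _) (norm_sum_le _ _) 2
    _ ≤ Fintype.card A * ∑ a, ‖ψ k (a, a)‖ ^ 2 := sq_sum_le_card_mul_sum_sq
    _ ≤ Fintype.card A * ∑ i, ‖ψ k i‖ ^ 2 := by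
        refine mul_le_mul_of_nonneg_left ?_ (Nat.cast_nonneg _)
        rw [Fintype.sum_prod_type]
        exact Finset.sum_le_sum fun a _ =>
          Finset.single_le_sum (f := fun b => ‖ψ k (a, b)‖ ^ 2) (fun _ _ => by positivity)
            (Finset.mem_univ a)
    _ = (∑ i, ‖ψ k i‖ ^ 2) * Fintype.card A := mul_comm _ _

theorem one_div_sqrt_card_mul_self (A : Type*) [Fintype A] :
    ((1 / √(Fintype.card A : ℝ) : ℝ) : ℂ) * ((1 / √(Fintype.card A : ℝ) : ℝ) : ℂ) =
      1 / (Fintype.card A : ℂ) := by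
  rw [← Complex.ofReal_mul, div_mul_div_comm, one_mul, Real.mul_self_sqrt (Nat.cast_nonneg _)]
  simp

section Embeddings

open scoped InnerProductSpace

variable {K : Type*}

/-- The isometry `w ↦ Φ_AB ⊗ w`, with `K` a purifying system. -/
def embedAB (w : EuclideanSpace ℂ (K × A)) : EuclideanSpace ℂ (K × A × A × A) :=
  WithLp.toLp 2 fun i => maxEntangled A (i.2.1, i.2.2.1) * w (i.1, i.2.2.2)

/-- The isometry `w ↦ Φ_AC ⊗ w`, with `K` a purifying system. -/
def embedAC (w : EuclideanSpace ℂ (K × A)) : EuclideanSpace ℂ (K × A × A × A) :=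
  WithLp.toLp 2 fun i => maxEntangled A (i.2.1, i.2.2.2) * w (i.1, i.2.2.1)

/-- The adjoint of `embedAB`. -/
def contractAB (ψ : EuclideanSpace ℂ (K × A × A × A)) : EuclideanSpace ℂ (K × A) :=
  WithLp.toLp 2 fun i => ((1 / √(Fintype.card A : ℝ) : ℝ) : ℂ) * ∑ a, ψ (i.1, a, a, i.2)

/-- The adjoint of `embedAC`. -/
def contractAC (ψ : EuclideanSpace ℂ (K × A × A × A)) : EuclideanSpace ℂ (K × A) :=
  WithLp.toLp 2 fun i => ((1 / √(Fintype.card A : ℝ) : ℝ) : ℂ) * ∑ a, ψ (i.1, a, i.2, a)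

theorem inner_embedAB [Fintype K] (w : EuclideanSpace ℂ (K × A))
    (ψ : EuclideanSpace ℂ (K × A × A × A)) : ⟪embedAB w, ψ⟫_ℂ = ⟪w, contractAB ψ⟫_ℂ := by
  simp only [embedAB, contractAB, maxEntangled, PiLp.inner_apply, RCLike.inner_apply,
    Fintype.sum_prod_type, apply_ite (starRingEnd ℂ), map_zero, map_mul, Complex.conj_ofReal,
    mul_ite, ite_mul, mul_zero, zero_mul, Finset.sum_ite_irrel, Finset.sum_const_zero,
    Finset.sum_ite_eq, Finset.mem_univ, if_true]
  refine Finset.sum_congr rfl fun k _ => ?_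
  rw [Finset.sum_comm]
  refine Finset.sum_congr rfl fun c _ => ?_
  rw [Finset.mul_sum, Finset.sum_mul]
  exact Finset.sum_congr rfl fun a _ => by ring

theorem inner_embedAC [Fintype K] (w : EuclideanSpace ℂ (K × A))
    (ψ : EuclideanSpace ℂ (K × A × A × A)) : ⟪embedAC w, ψ⟫_ℂ = ⟪w, contractAC ψ⟫_ℂ := by
  simp only [embedAC, contractAC, maxEntangled, PiLp.inner_apply, RCLike.inner_apply,
    Fintype.sum_prod_type, apply_ite (starRingEnd ℂ), map_zero, map_mul, Complex.conj_ofReal,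
    mul_ite, ite_mul, mul_zero, zero_mul, Finset.sum_ite_eq, Finset.mem_univ, if_true]
  refine Finset.sum_congr rfl fun k _ => ?_
  rw [Finset.sum_comm]
  refine Finset.sum_congr rfl fun c _ => ?_
  rw [Finset.mul_sum, Finset.sum_mul]
  exact Finset.sum_congr rfl fun a _ => by ring

theorem contractAB_embedAB [Nonempty A] (w : EuclideanSpace ℂ (K × A)) :
    contractAB (embedAB w) = w := by
  ext i
  have hd : (Fintype.card A : ℂ) ≠ 0 := by simp
  simp only [contractAB, embedAB, maxEntangled, if_true, Finset.sum_const, Finset.card_univ,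
    nsmul_eq_mul]
  linear_combination Fintype.card A * w i * one_div_sqrt_card_mul_self A +
    w i * mul_one_div_cancel hd

theorem contractAC_embedAC [Nonempty A] (w : EuclideanSpace ℂ (K × A)) :
    contractAC (embedAC w) = w := by
  ext i
  have hd : (Fintype.card A : ℂ) ≠ 0 := by simp
  simp only [contractAC, embedAC, maxEntangled, if_true, Finset.sum_const, Finset.card_univ,
    nsmul_eq_mul]
  linear_combination Fintype.card A * w i * one_div_sqrt_card_mul_self A +
    w i * mul_one_div_cancel hd

/-- This is the origin of `c = 1/d`: contracting `Φ_AB` with `Φ_AC` carries the content of `B` to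
`C` unchanged, at the cost of two factors `1/√d`. -/
theorem contractAB_embedAC (w : EuclideanSpace ℂ (K × A)) :
    contractAB (embedAC w) = ((1 / (Fintype.card A : ℝ) : ℝ) : ℂ) • w := by
  ext i
  simp only [contractAB, embedAC, maxEntangled, ite_mul, zero_mul, Finset.sum_ite_eq',
    Finset.mem_univ, if_true, PiLp.smul_apply, smul_eq_mul]
  have h := one_div_sqrt_card_mul_self A
  push_cast at h ⊢
  linear_combination w i * h

end Embeddings

/-- The index `K` of the rank-one decomposition serves as the purifying register. -/
theorem recoveryFidelity_id_ellipse_of_sum [Nonempty A] {K : Type*} [Fintype K]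
    {τ : Matrix (A × A × A) (A × A × A) ℂ} {ψ : K → A × A × A → ℂ}
    (h : ∀ i j, τ i j = ∑ k, ψ k i * star (ψ k j)) (htr : ∑ k, ∑ i, ‖ψ k i‖ ^ 2 = 1) :
    recoveryFidelity (marginalAB τ) LinearMap.id + recoveryFidelity (marginalAC τ) LinearMap.id -
      2 * (1 / (Fintype.card A : ℝ)) * (√(recoveryFidelity (marginalAB τ) LinearMap.id) *
        √(recoveryFidelity (marginalAC τ) LinearMap.id)) ≤ 1 - (1 / (Fintype.card A : ℝ)) ^ 2 := by
  have hd : (1 : ℝ) ≤ Fintype.card A := by exact_mod_cast Fintype.card_pos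
  have hss : (1 / √(Fintype.card A : ℝ)) ^ 2 = 1 / (Fintype.card A : ℝ) := by
    rw [div_pow, one_pow, Real.sq_sqrt (Nat.cast_nonneg _)]
  let Ψ : EuclideanSpace ℂ (K × A × A × A) := WithLp.toLp 2 fun i => ψ i.1 i.2
  have hx : recoveryFidelity (marginalAB τ) LinearMap.id = ‖contractAB Ψ‖ ^ 2 := by
    -- Tracing out `C` adds its basis label to the ensemble index.
    rw [recoveryFidelity_id_of_sum (K := K × A)
      (ψ := fun k p => ψ k.1 (p.1, p.2, k.2)), EuclideanSpace.norm_sq_eq]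
    · simp only [contractAB, Ψ, norm_mul, mul_pow, Complex.norm_real, Real.norm_eq_abs, sq_abs,
        ← Finset.mul_sum]
      rw [hss]; ring
    · intro i j
      simp only [marginalAB, h]
      rw [Fintype.sum_prod_type]
      exact Finset.sum_comm
  have hz : recoveryFidelity (marginalAC τ) LinearMap.id = ‖contractAC Ψ‖ ^ 2 := by
    rw [recoveryFidelity_id_of_sum (K := K × A)
      (ψ := fun k p => ψ k.1 (p.1, k.2, p.2)), EuclideanSpace.norm_sq_eq]
    · simp only [contractAC, Ψ, norm_mul, mul_pow, Complex.norm_real, Real.norm_eq_abs, sq_abs,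
        ← Finset.mul_sum]
      rw [hss]; ring
    · intro i j
      simp only [marginalAC, h]
      rw [Fintype.sum_prod_type]
      exact Finset.sum_comm
  have hΨ : ‖Ψ‖ ^ 2 = 1 := by
    rw [← htr, EuclideanSpace.norm_sq_eq, Fintype.sum_prod_type]
  have hc : (1 / (Fintype.card A : ℝ)) ^ 2 ≤ 1 := by
    rw [one_div, inv_pow]
    exact inv_le_one_of_one_le₀ (one_le_pow₀ hd)
  have key := norm_sub_smul_sq_le (S := embedAB) (T := embedAC) hc
    (fun v w => by rw [inner_embedAB, contractAB_embedAB])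
    (fun v w => by rw [inner_embedAC, contractAC_embedAC])
    (fun v w => by rw [inner_embedAB, contractAB_embedAC, inner_smul_right])
    (fun w => inner_embedAB w Ψ) (fun w => inner_embedAC w Ψ)
  rw [hΨ] at key
  rw [hx, hz, Real.sqrt_sq (norm_nonneg _), Real.sqrt_sq (norm_nonneg _)]
  -- The reverse triangle inequality leaves only norms: `(√z - c√x)² ≤ (1 - c²)(1 - x)`, which
  -- rearranges to the ellipse.
  have hle : (‖contractAC Ψ‖ - 1 / (Fintype.card A : ℝ) * ‖contractAB Ψ‖) ^ 2 ≤
      ‖contractAC Ψ - ((1 / (Fintype.card A : ℝ) : ℝ) : ℂ) • contractAB Ψ‖ ^ 2 := by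
    have := abs_norm_sub_norm_le (contractAC Ψ)
      (((1 / (Fintype.card A : ℝ) : ℝ) : ℂ) • contractAB Ψ)
    rwa [norm_smul, Complex.norm_real, Real.norm_of_nonneg (by positivity), ← abs_norm (_ - _),
      ← sq_le_sq] at this
  nlinarith

/-- Singlet monogamy for three systems, with trivial recovery. -/
theorem recoveryFidelity_id_ellipse {τ : Matrix (A × A × A) (A × A × A) ℂ} (hτ : IsState τ) :
    recoveryFidelity (marginalAB τ) LinearMap.id + recoveryFidelity (marginalAC τ) LinearMap.id -
      2 * (1 / (Fintype.card A : ℝ)) * (√(recoveryFidelity (marginalAB τ) LinearMap.id) *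
        √(recoveryFidelity (marginalAC τ) LinearMap.id)) ≤ 1 - (1 / (Fintype.card A : ℝ)) ^ 2 := by
  have hA : Nonempty A := by
    by_contra hA
    rw [not_nonempty_iff] at hA
    simpa [Matrix.trace] using hτ.2
  obtain ⟨ψ, h⟩ := exists_sum_of_posSemidef hτ.1
  have htr := trace_re_of_sum h
  rw [hτ.2, Complex.one_re] at htr
  exact recoveryFidelity_id_ellipse_of_sum h htr.symm

end Fidelity

/-! ### Real analysis of the ellipse and of the curve traced by the superposition. -/

section Ellipse

/-- The left side need not be monotone in `x` and `z`, so the suprema are reached through closedness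
of the region; `X ×ˢ Z` is a product because the two recoveries are chosen independently. -/
theorem ellipse_csSup {X Z : Set ℝ} {c : ℝ} (hX : X.Nonempty) (hZ : Z.Nonempty)
    (bX : BddAbove X) (bZ : BddAbove Z)
    (h : ∀ x ∈ X, ∀ z ∈ Z, x + z - 2 * c * (√x * √z) ≤ 1 - c ^ 2) :
    sSup X + sSup Z - 2 * c * (√(sSup X) * √(sSup Z)) ≤ 1 - c ^ 2 := by
  have hcl : IsClosed {p : ℝ × ℝ | p.1 + p.2 - 2 * c * (√p.1 * √p.2) ≤ 1 - c ^ 2} :=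
    isClosed_le (by fun_prop) continuous_const
  have hm : (sSup X, sSup Z) ∈ closure (X ×ˢ Z) := by
    rw [closure_prod_eq]
    exact ⟨csSup_mem_closure hX bX, csSup_mem_closure hZ bZ⟩
  exact closure_minimal (s := X ×ˢ Z) (fun p hp => h p.1 hp.1 p.2 hp.2) hcl hm

variable {d x z : ℝ}

theorem bound_of_ellipse (hd : 1 ≤ d) (hx0 : 0 ≤ x) (hz0 : 0 ≤ z)
    (h : x + z - 2 * (1 / d) * (√x * √z) ≤ 1 - (1 / d) ^ 2) :
    d ^ 2 * z ≤ (√x + √(d ^ 2 - 1) * √(1 - x)) ^ 2 := by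
  have hd0 : 0 < d := by linarith
  have hd2 : 0 ≤ d ^ 2 - 1 := by nlinarith
  -- Multiplied by `d²`, the ellipse reads `(d√z - √x)² ≤ (d² - 1)(1 - x)`.
  have h1 : d * √z - √x ≤ √(d ^ 2 - 1) * √(1 - x) := by
    rw [← Real.sqrt_mul hd2]
    apply Real.le_sqrt_of_sq_le
    have h2 := mul_le_mul_of_nonneg_left h (sq_nonneg d)
    have h3 : d ^ 2 * (x + z - 2 * (1 / d) * (√x * √z)) =
        d ^ 2 * x + d ^ 2 * z - 2 * d * (√x * √z) := by field_simp
    have h4 : d ^ 2 * (1 - (1 / d) ^ 2) = d ^ 2 - 1 := by field_simp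
    rw [h3, h4] at h2
    calc (d * √z - √x) ^ 2 = d ^ 2 * √z ^ 2 + √x ^ 2 - 2 * d * (√x * √z) := by ring
      _ ≤ (d ^ 2 - 1) * (1 - x) := by
        rw [Real.sq_sqrt hx0, Real.sq_sqrt hz0]; nlinarith
  calc d ^ 2 * z = (d * √z) ^ 2 := by rw [mul_pow, Real.sq_sqrt hz0]
    _ ≤ _ := pow_le_pow_left₀ (by positivity) (by linarith) 2

theorem sum_bound_of_ellipse (hd : 1 ≤ d) (hx0 : 0 ≤ x) (hz0 : 0 ≤ z)
    (h : x + z - 2 * (1 / d) * (√x * √z) ≤ 1 - (1 / d) ^ 2) :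
    x + z ≤ (d - 1) / d + (√x + √z) ^ 2 / (d + 1) := by
  have hd0 : 0 < d := by linarith
  -- The slack here is `d/(d+1)` times the slack of the ellipse.
  have h1 : (d - 1) / d + (x + z + 2 * (√x * √z)) / (d + 1) - (x + z) =
      d / (d + 1) * (1 - (1 / d) ^ 2 - (x + z - 2 * (1 / d) * (√x * √z))) := by
    field_simp
    ring
  have h2 : (√x + √z) ^ 2 = x + z + 2 * (√x * √z) := by
    rw [add_sq, Real.sq_sqrt hx0, Real.sq_sqrt hz0]; ring
  rw [h2]
  have h3 : 0 ≤ d / (d + 1) * (1 - (1 / d) ^ 2 - (x + z - 2 * (1 / d) * (√x * √z))) :=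
    mul_nonneg (by positivity) (by linarith)
  linarith

/-- The fidelity of the superposition state under trivial recovery. -/
def superpositionFidelity (d θ : ℝ) : ℝ :=
  (d * Real.cos θ + Real.sin θ) ^ 2 / (d * (d + Real.sin (2 * θ)))

/-- Reflecting `θ` to `π/2 - θ` exchanges `B` and `C`, so one function describes both fidelities. -/
theorem superpositionFidelity_pi_div_two_sub (d θ : ℝ) :
    superpositionFidelity d (Real.pi / 2 - θ) =
      (d * Real.sin θ + Real.cos θ) ^ 2 / (d * (d + Real.sin (2 * θ))) := by
  rw [superpositionFidelity, Real.cos_pi_div_two_sub, Real.sin_pi_div_two_sub,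
    show 2 * (Real.pi / 2 - θ) = Real.pi - 2 * θ by ring, Real.sin_pi_sub]

theorem sin_cos_nonneg_of_mem_Icc {θ : ℝ} (hθ : θ ∈ Set.Icc 0 (Real.pi / 2)) :
    0 ≤ Real.sin θ ∧ 0 ≤ Real.cos θ :=
  ⟨Real.sin_nonneg_of_nonneg_of_le_pi hθ.1 (by linarith [hθ.2, Real.pi_pos]),
    Real.cos_nonneg_of_mem_Icc ⟨by linarith [hθ.1, Real.pi_pos], hθ.2⟩⟩

theorem superpositionFidelity_denom_pos (hd : 1 ≤ d) {θ : ℝ}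
    (hθ : θ ∈ Set.Icc 0 (Real.pi / 2)) : 0 < d * (d + Real.sin (2 * θ)) := by
  obtain ⟨hs, hc⟩ := sin_cos_nonneg_of_mem_Icc hθ
  rw [Real.sin_two_mul]
  have : 0 < d := by linarith
  positivity

/-- Writing both fidelities as squares with a common factor `m` turns later square-root identities
into polynomial ones. -/
theorem exists_superpositionFidelity_eq_sq (hd : 1 ≤ d) {θ : ℝ}
    (hθ : θ ∈ Set.Icc 0 (Real.pi / 2)) : ∃ m : ℝ, 0 ≤ m ∧
      m ^ 2 * (d * (d + 2 * Real.sin θ * Real.cos θ)) = 1 ∧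
      superpositionFidelity d θ = ((d * Real.cos θ + Real.sin θ) * m) ^ 2 ∧
      superpositionFidelity d (Real.pi / 2 - θ) = ((d * Real.sin θ + Real.cos θ) * m) ^ 2 := by
  have hD := superpositionFidelity_denom_pos hd hθ
  have hm : (1 / √(d * (d + Real.sin (2 * θ)))) ^ 2 = 1 / (d * (d + Real.sin (2 * θ))) := by
    rw [div_pow, one_pow, Real.sq_sqrt hD.le]
  refine ⟨1 / √(d * (d + Real.sin (2 * θ))), by positivity, ?_, ?_, ?_⟩
  · rw [hm, ← Real.sin_two_mul]
    exact one_div_mul_cancel hD.ne'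
  · rw [mul_pow, hm, superpositionFidelity]; ring
  · rw [mul_pow, hm, superpositionFidelity_pi_div_two_sub]; ring

theorem superpositionFidelity_equality (hd : 1 ≤ d) {θ : ℝ} (hθ : θ ∈ Set.Icc 0 (Real.pi / 2)) :
    d ^ 2 * superpositionFidelity d (Real.pi / 2 - θ) =
      (√(superpositionFidelity d θ) + √(d ^ 2 - 1) * √(1 - superpositionFidelity d θ)) ^ 2 := by
  obtain ⟨hs, hc⟩ := sin_cos_nonneg_of_mem_Icc hθ
  obtain ⟨m, hm, hm2, h1, h2⟩ := exists_superpositionFidelity_eq_sq hd hθ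
  have hd2 : 0 ≤ d ^ 2 - 1 := by nlinarith
  have hsc := Real.sin_sq_add_cos_sq θ
  have h3 : (d ^ 2 - 1) * (1 - ((d * Real.cos θ + Real.sin θ) * m) ^ 2) =
      ((d ^ 2 - 1) * (Real.sin θ * m)) ^ 2 := by
    linear_combination (-(d ^ 2 - 1)) * hm2 - (d ^ 2 - 1) * d ^ 2 * m ^ 2 * hsc
  rw [← Real.sqrt_mul hd2, h1, h2, h3, Real.sqrt_sq (by positivity), Real.sqrt_sq (by positivity)]
  ring

/-- Points above the curve `θ ↦ (F(θ), F(π/2 - θ))` leave the ellipse. -/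
theorem eq_superpositionFidelity_of_ellipse (hd : 1 ≤ d) {θ : ℝ}
    (hθ : θ ∈ Set.Icc 0 (Real.pi / 2)) (hx : superpositionFidelity d θ ≤ x)
    (hz : superpositionFidelity d (Real.pi / 2 - θ) ≤ z) (hx1 : x ≤ 1) (hz1 : z ≤ 1)
    (h : x + z - 2 * (1 / d) * (√x * √z) ≤ 1 - (1 / d) ^ 2) :
    x = superpositionFidelity d θ ∧ z = superpositionFidelity d (Real.pi / 2 - θ) := by
  obtain ⟨hs, hc⟩ := sin_cos_nonneg_of_mem_Icc hθ
  obtain ⟨m, hm, hm2, h1, h2⟩ := exists_superpositionFidelity_eq_sq hd hθ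
  have hd0 : 0 < d := by linarith
  have hsc := Real.sin_sq_add_cos_sq θ
  rw [h1] at hx ⊢
  rw [h2] at hz ⊢
  have hx0 : 0 ≤ x := (sq_nonneg _).trans hx
  have hz0 : 0 ≤ z := (sq_nonneg _).trans hz
  have hP := Real.le_sqrt_of_sq_le hx
  have hQ := Real.le_sqrt_of_sq_le hz
  have hxs := Real.sq_sqrt hx0
  have hzs := Real.sq_sqrt hz0
  set p := (d * Real.cos θ + Real.sin θ) * m with hp
  set q := (d * Real.sin θ + Real.cos θ) * m with hq
  rcases hd.eq_or_lt with rfl | hd1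
  -- For `d = 1` the ellipse degenerates to `√x = √z`; here `p = q = 1` and the bounds `x, z ≤ 1`
  -- decide.
  · have hpq : p = q := by rw [hp, hq]; ring
    have : p ^ 2 = 1 := by rw [hp]; linear_combination hm2 + m ^ 2 * hsc
    rw [← hpq] at hz ⊢
    exact ⟨by linarith, by linarith⟩
  · have hc1 : 1 / d < 1 := by rw [div_lt_one hd0]; exact hd1
    have hc0 : 0 < 1 / d := by positivity
    have hcd : 1 / d * d = 1 := one_div_mul_cancel hd0.ne'
    set c := 1 / d with hcdef
    -- `p - cq` and `q - cp` are half the partial derivatives at `(p, q)` of the quadratic form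
    -- defining the ellipse.
    have e1 : 0 ≤ p - c * q := by
      have : p - c * q = (d - c) * Real.cos θ * m := by
        rw [hp, hq]; linear_combination (-(Real.sin θ * m)) * hcd
      rw [this]
      have : 0 ≤ d - c := by linarith
      positivity
    have e2 : 0 ≤ q - c * p := by
      have : q - c * p = (d - c) * Real.sin θ * m := by
        rw [hp, hq]; linear_combination (-(Real.cos θ * m)) * hcd
      rw [this]
      have : 0 ≤ d - c := by linarith
      positivity
    have e3 : p ^ 2 + q ^ 2 - 2 * c * (p * q) = 1 - c ^ 2 := by
      have : d ^ 2 * (p ^ 2 + q ^ 2 - 2 * c * (p * q)) = d ^ 2 * (1 - c ^ 2) := by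
        have f1 : d ^ 2 * (p ^ 2 + q ^ 2 - 2 * c * (p * q)) =
            d ^ 2 * (p ^ 2 + q ^ 2) - 2 * d * (p * q) := by
          linear_combination (-2 * d * (p * q)) * hcd
        have f2 : d ^ 2 * (1 - c ^ 2) = d ^ 2 - 1 := by
          linear_combination (-(c * d) - 1) * hcd
        rw [f1, f2, hp, hq]
        linear_combination (d ^ 2 - 1) * hm2 + m ^ 2 * (d ^ 4 - d ^ 2) * hsc
      exact mul_left_cancel₀ (by positivity) this
    -- Taylor expansion at the boundary point `(p, q)`: the linear terms are nonnegative, and the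
    -- quadratic part is `a² + b² - 2cab = (1 - c)(a² + b²) + c(a - b)²`.
    have e4 : (1 - c) * ((√x - p) ^ 2 + (√z - q) ^ 2) ≤ 0 := by
      have f0 : √x ^ 2 + √z ^ 2 - 2 * c * (√x * √z) ≤ 1 - c ^ 2 := by rwa [hxs, hzs]
      have f1 := mul_nonneg (sub_nonneg.2 hP) e1
      have f2 := mul_nonneg (sub_nonneg.2 hQ) e2
      have f3 := mul_nonneg hc0.le (sq_nonneg ((√x - p) - (√z - q)))
      have f4 : (1 - c) * ((√x - p) ^ 2 + (√z - q) ^ 2) =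
          (√x ^ 2 + √z ^ 2 - 2 * c * (√x * √z)) - (p ^ 2 + q ^ 2 - 2 * c * (p * q)) -
            2 * ((√x - p) * (p - c * q)) - 2 * ((√z - q) * (q - c * p)) -
            c * ((√x - p) - (√z - q)) ^ 2 := by ring
      linarith
    have e5 : (√x - p) ^ 2 + (√z - q) ^ 2 ≤ 0 := by
      by_contra hne
      exact absurd (mul_pos (sub_pos.2 hc1) (not_le.1 hne)) (not_lt.2 e4)
    have e6 : √x - p = 0 := pow_eq_zero_iff two_ne_zero |>.1
      (le_antisymm (by linarith [sq_nonneg (√z - q)]) (sq_nonneg _))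
    have e7 : √z - q = 0 := pow_eq_zero_iff two_ne_zero |>.1
      (le_antisymm (by linarith [sq_nonneg (√x - p)]) (sq_nonneg _))
    rw [← hxs, ← hzs, sub_eq_zero.1 e6, sub_eq_zero.1 e7]
    exact ⟨rfl, rfl⟩

theorem superpositionFidelity_zero (hd : 1 ≤ d) : superpositionFidelity d 0 = 1 := by
  have : d ≠ 0 := by linarith
  simp [superpositionFidelity]
  field_simp

theorem superpositionFidelity_pi_div_two (d : ℝ) :
    superpositionFidelity d (Real.pi / 2) = 1 / d ^ 2 := by
  rw [superpositionFidelity, show 2 * (Real.pi / 2) = Real.pi by ring]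
  simp [pow_two]

theorem exists_superpositionFidelity_eq (hd : 1 ≤ d) {r : ℝ} (hr : r ∈ Set.Icc (1 / d ^ 2) 1) :
    ∃ θ ∈ Set.Icc 0 (Real.pi / 2), superpositionFidelity d θ = r := by
  have hcont : ContinuousOn (superpositionFidelity d) (Set.Icc 0 (Real.pi / 2)) :=
    ContinuousOn.div (by fun_prop) (by fun_prop)
      fun θ hθ => (superpositionFidelity_denom_pos hd hθ).ne'
  have := intermediate_value_Icc' (by positivity) hcont
  rw [superpositionFidelity_zero hd, superpositionFidelity_pi_div_two] at this
  exact this hr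

theorem exists_le_superpositionFidelity (hd : 1 ≤ d) (hx0 : 0 ≤ x) (hx1 : x ≤ 1) (hz0 : 0 ≤ z)
    (hz1 : z ≤ 1) (h : x + z - 2 * (1 / d) * (√x * √z) ≤ 1 - (1 / d) ^ 2) :
    ∃ θ ∈ Set.Icc 0 (Real.pi / 2), x ≤ superpositionFidelity d θ ∧
      z ≤ superpositionFidelity d (Real.pi / 2 - θ) := by
  rcases le_total x (1 / d ^ 2) with hx | hx
  -- Below the range of the curve, its endpoint `(1/d², 1)` already dominates; otherwise `θ` is
  -- chosen to match `x` exactly.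
  · refine ⟨Real.pi / 2, ⟨by positivity, le_rfl⟩, ?_, ?_⟩
    · rwa [superpositionFidelity_pi_div_two]
    · rwa [sub_self, superpositionFidelity_zero hd]
  · obtain ⟨θ, hθ, rfl⟩ := exists_superpositionFidelity_eq hd ⟨hx, hx1⟩
    refine ⟨θ, hθ, le_rfl, ?_⟩
    have h1 := bound_of_ellipse hd hx0 hz0 h
    rw [← superpositionFidelity_equality hd hθ] at h1
    have hd0 : 0 < d := by linarith
    exact le_of_mul_le_mul_left h1 (by positivity)

end Ellipse

/-! ### Suprema over channels and over unitaries. -/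

section Optima

theorem IsState.nonempty_left {A B : Type*} [Fintype A] [Fintype B]
    {σ : Matrix (A × B) (A × B) ℂ} (hσ : IsState σ) : Nonempty A := by
  by_contra hA
  rw [not_nonempty_iff] at hA
  simpa [Matrix.trace] using hσ.2

theorem one_le_card_of_nonempty {A : Type*} [Fintype A] [Nonempty A] : (1 : ℝ) ≤ Fintype.card A := by
  exact_mod_cast Fintype.card_pos

variable {A B C : Type*} [Fintype A] [DecidableEq A] [Fintype B] [Fintype C]

theorem recoveryFidelity_mem_Icc {σ : Matrix (A × B) (A × B) ℂ} (hσ : IsState σ)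
    {E : Matrix B B ℂ →ₗ[ℂ] Matrix A A ℂ} (hE : IsChannel E) :
    recoveryFidelity σ E ∈ Set.Icc 0 1 := by
  rw [← recoveryFidelity_idTensor]
  exact ⟨recoveryFidelity_id_nonneg (hE.isState_idTensor hσ),
    recoveryFidelity_id_le_one (hE.isState_idTensor hσ)⟩

theorem recoveryFidelity_depolarize {σ : Matrix (A × B) (A × B) ℂ} (hσ : IsState σ) :
    recoveryFidelity σ (depolarize B A) = 1 / (Fintype.card A : ℝ) ^ 2 := by
  have h : ∑ a, ∑ a', idTensor A (depolarize B A) σ (a, a) (a', a') =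
      ((1 / (Fintype.card A : ℝ) : ℝ) : ℂ) := by
    have h2 : ∑ a, ∑ a', idTensor A (depolarize B A) σ (a, a) (a', a') =
        σ.trace * (Fintype.card A : ℂ)⁻¹ := by
      simp [idTensor_apply, depolarize_apply, Matrix.one_apply, Matrix.trace,
        Fintype.sum_prod_type, Finset.sum_mul]
    rw [h2, hσ.2]
    simp
  rw [recoveryFidelity_eq, h, Complex.ofReal_re, div_div, ← pow_two]

theorem bddAbove_Ropt {σ : Matrix (A × B) (A × B) ℂ} (hσ : IsState σ) :
    BddAbove {r : ℝ | ∃ E : Matrix B B ℂ →ₗ[ℂ] Matrix A A ℂ,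
      IsChannel E ∧ r = recoveryFidelity σ E} := by
  refine ⟨1, ?_⟩
  rintro r ⟨E, hE, rfl⟩
  exact (recoveryFidelity_mem_Icc hσ hE).2

theorem nonempty_Ropt {σ : Matrix (A × B) (A × B) ℂ} (hσ : IsState σ) :
    {r : ℝ | ∃ E : Matrix B B ℂ →ₗ[ℂ] Matrix A A ℂ,
      IsChannel E ∧ r = recoveryFidelity σ E}.Nonempty :=
  have := hσ.nonempty_left
  ⟨_, depolarize B A, isChannel_depolarize, rfl⟩

theorem le_Ropt {σ : Matrix (A × B) (A × B) ℂ} (hσ : IsState σ)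
    {E : Matrix B B ℂ →ₗ[ℂ] Matrix A A ℂ} (hE : IsChannel E) : recoveryFidelity σ E ≤ Ropt σ :=
  le_csSup (bddAbove_Ropt hσ) ⟨E, hE, rfl⟩

/-- The lower bound comes from discarding `B` and preparing the maximally mixed state. -/
theorem Ropt_mem_Icc {σ : Matrix (A × B) (A × B) ℂ} (hσ : IsState σ) :
    Ropt σ ∈ Set.Icc (1 / (Fintype.card A : ℝ) ^ 2) 1 := by
  have := hσ.nonempty_left
  refine ⟨?_, csSup_le (nonempty_Ropt hσ) ?_⟩
  · rw [← recoveryFidelity_depolarize hσ]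
    exact le_Ropt hσ isChannel_depolarize
  · rintro r ⟨E, hE, rfl⟩
    exact (recoveryFidelity_mem_Icc hσ hE).2

theorem Ropt_nonneg {σ : Matrix (A × B) (A × B) ℂ} (hσ : IsState σ) : 0 ≤ Ropt σ :=
  le_trans (by positivity) (Ropt_mem_Icc hσ).1

theorem nonempty_Runitary (σ : Matrix (A × A) (A × A) ℂ) :
    {r : ℝ | ∃ U ∈ Matrix.unitaryGroup A ℂ, r = recoveryFidelity σ (conjMap U)}.Nonempty :=
  ⟨_, 1, one_mem _, rfl⟩

theorem bddAbove_Runitary {σ : Matrix (A × A) (A × A) ℂ} (hσ : IsState σ) :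
    BddAbove {r : ℝ | ∃ U ∈ Matrix.unitaryGroup A ℂ, r = recoveryFidelity σ (conjMap U)} := by
  refine ⟨1, ?_⟩
  rintro r ⟨U, hU, rfl⟩
  exact (recoveryFidelity_mem_Icc hσ (isChannel_conjMap hU)).2

theorem recoveryFidelity_id_le_Runitary {σ : Matrix (A × A) (A × A) ℂ} (hσ : IsState σ) :
    recoveryFidelity σ LinearMap.id ≤ Runitary σ :=
  le_csSup (bddAbove_Runitary hσ) ⟨1, one_mem _, by rw [conjMap_one]⟩

theorem Runitary_le_Ropt {σ : Matrix (A × A) (A × A) ℂ} (hσ : IsState σ) :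
    Runitary σ ≤ Ropt σ := by
  refine csSup_le (nonempty_Runitary σ) ?_
  rintro r ⟨U, hU, rfl⟩
  exact le_Ropt hσ (isChannel_conjMap hU)

theorem Runitary_mem_Icc {σ : Matrix (A × A) (A × A) ℂ} (hσ : IsState σ) :
    Runitary σ ∈ Set.Icc 0 1 :=
  ⟨(recoveryFidelity_id_nonneg hσ).trans (recoveryFidelity_id_le_Runitary hσ),
    (Runitary_le_Ropt hσ).trans (Ropt_mem_Icc hσ).2⟩

/-- Monogamy of the recovery fidelities under arbitrary recovery channels. -/
theorem recoveryFidelity_ellipse {ρ : Matrix (A × B × C) (A × B × C) ℂ} (hρ : IsState ρ)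
    {F : Matrix B B ℂ →ₗ[ℂ] Matrix A A ℂ} {E : Matrix C C ℂ →ₗ[ℂ] Matrix A A ℂ}
    (hF : IsChannel F) (hE : IsChannel E) :
    recoveryFidelity (marginalAB ρ) F + recoveryFidelity (marginalAC ρ) E -
      2 * (1 / (Fintype.card A : ℝ)) *
        (√(recoveryFidelity (marginalAB ρ) F) * √(recoveryFidelity (marginalAC ρ) E)) ≤
      1 - (1 / (Fintype.card A : ℝ)) ^ 2 := by
  have h := recoveryFidelity_id_ellipse (isState_localChannels hF hE hρ)
  rwa [marginalAB_localChannels hE, marginalAC_localChannels hF, recoveryFidelity_idTensor,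
    recoveryFidelity_idTensor] at h

theorem Ropt_ellipse {ρ : Matrix (A × B × C) (A × B × C) ℂ} (hρ : IsState ρ) :
    Ropt (marginalAB ρ) + Ropt (marginalAC ρ) -
      2 * (1 / (Fintype.card A : ℝ)) * (√(Ropt (marginalAB ρ)) * √(Ropt (marginalAC ρ))) ≤
      1 - (1 / (Fintype.card A : ℝ)) ^ 2 := by
  refine ellipse_csSup (nonempty_Ropt hρ.marginalAB) (nonempty_Ropt hρ.marginalAC)
    (bddAbove_Ropt hρ.marginalAB) (bddAbove_Ropt hρ.marginalAC) ?_
  rintro _ ⟨F, hF, rfl⟩ _ ⟨E, hE, rfl⟩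
  exact recoveryFidelity_ellipse hρ hF hE

theorem Runitary_ellipse {ρ : Matrix (A × A × A) (A × A × A) ℂ} (hρ : IsState ρ) :
    Runitary (marginalAB ρ) + Runitary (marginalAC ρ) -
      2 * (1 / (Fintype.card A : ℝ)) * (√(Runitary (marginalAB ρ)) * √(Runitary (marginalAC ρ))) ≤
      1 - (1 / (Fintype.card A : ℝ)) ^ 2 := by
  refine ellipse_csSup (nonempty_Runitary _) (nonempty_Runitary _)
    (bddAbove_Runitary hρ.marginalAB) (bddAbove_Runitary hρ.marginalAC) ?_
  rintro _ ⟨U, hU, rfl⟩ _ ⟨V, hV, rfl⟩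
  exact recoveryFidelity_ellipse hρ (isChannel_conjMap hU) (isChannel_conjMap hV)

end Optima

/-! ### The extremal state and its fidelities. -/

section Superposition

variable {A : Type*} [Fintype A] [DecidableEq A]

theorem superpositionNorm_pi_div_two_sub (A : Type*) [Fintype A] (θ : ℝ) :
    superpositionNorm A (Real.pi / 2 - θ) = superpositionNorm A θ := by
  rw [superpositionNorm, superpositionNorm, show 2 * (Real.pi / 2 - θ) = Real.pi - 2 * θ by ring,
    Real.sin_pi_sub]

theorem superposition_pi_div_two_sub (o : A) (θ : ℝ) (a b c : A) :
    superposition o (Real.pi / 2 - θ) (a, b, c) = superposition o θ (a, c, b) := by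
  rw [superposition, superposition, superpositionNorm_pi_div_two_sub, Real.cos_pi_div_two_sub,
    Real.sin_pi_div_two_sub]
  ring

theorem marginalAC_superpositionState (o : A) (θ : ℝ) :
    marginalAC (superpositionState o θ) =
      marginalAB (superpositionState o (Real.pi / 2 - θ)) := by
  ext p q
  simp only [marginalAC, marginalAB, superpositionState, ketbra, Matrix.vecMulVec_apply,
    Pi.star_apply, superposition_pi_div_two_sub]

theorem isState_superpositionState (o : A) {θ : ℝ} (hN : 0 < superpositionNorm A θ) :
    IsState (superpositionState o θ) := by
  have : Nonempty A := ⟨o⟩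
  have hd : (Fintype.card A : ℂ) ≠ 0 := by simp
  refine ⟨Matrix.posSemidef_vecMulVec_self_star _, ?_⟩
  set n : ℂ := ((1 / √(superpositionNorm A θ) : ℝ) : ℂ) with hn
  have hn2 : n * n * superpositionNorm A θ = 1 := by
    rw [hn, ← Complex.ofReal_mul, ← Complex.ofReal_mul, div_mul_div_comm, one_mul,
      Real.mul_self_sqrt hN.le, one_div_mul_cancel hN.ne', Complex.ofReal_one]
  have hs := one_div_sqrt_card_mul_self A
  set s : ℂ := ((1 / √(Fintype.card A : ℝ) : ℝ) : ℂ) with hsdef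
  have hsum : (superpositionState o θ).trace = n * n * (Real.cos θ * Real.cos θ *
      (Fintype.card A * (s * s)) + Real.sin θ * Real.sin θ * (Fintype.card A * (s * s)) +
        2 * (Real.cos θ * Real.sin θ) * (s * s)) := by
    -- The cross term survives only at `a = b = c = o`, contributing the `sin(2θ)/d` of the
    -- normalization.
    have hterm : ∀ p : A × A × A, superposition o θ p * star (superposition o θ p) =
        n * n * (Real.cos θ * Real.cos θ *
            (if p.1 = p.2.1 then if p.2.2 = o then s * s else 0 else 0) +
          Real.sin θ * Real.sin θ *
            (if p.1 = p.2.2 then if p.2.1 = o then s * s else 0 else 0) +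
          2 * (Real.cos θ * Real.sin θ) *
            (if p.1 = p.2.1 then if p.1 = p.2.2 then if p.2.1 = o then if p.2.2 = o
              then s * s else 0 else 0 else 0 else 0)) := by
      intro p
      have hreal : star (superposition o θ p) = superposition o θ p := by
        simp only [superposition, maxEntangled, star_mul', star_add, apply_ite star, star_zero,
          star_one, Complex.star_def, Complex.conj_ofReal]
      rw [hreal]
      simp only [superposition, maxEntangled, ← hn, ← hsdef]
      split_ifs <;> ring
    simp only [superpositionState, ketbra, Matrix.trace, Matrix.diag_apply,
      Matrix.vecMulVec_apply, Pi.star_apply, hterm]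
    rw [← Finset.mul_sum, Finset.sum_add_distrib, Finset.sum_add_distrib, ← Finset.mul_sum,
      ← Finset.mul_sum, ← Finset.mul_sum]
    simp only [Fintype.sum_prod_type, Finset.sum_ite_irrel, Finset.sum_const_zero,
      Finset.sum_ite_eq, Finset.sum_ite_eq', Finset.mem_univ, if_true, Finset.sum_const,
      Finset.card_univ, nsmul_eq_mul]
  have hN2 : (superpositionNorm A θ : ℂ) =
      1 + 2 * (Real.cos θ * Real.sin θ) * (1 / (Fintype.card A : ℂ)) := by
    rw [superpositionNorm, Real.sin_two_mul]
    push_cast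
    ring
  have hcs : (Real.cos θ : ℂ) * Real.cos θ + Real.sin θ * Real.sin θ = 1 := by
    have := Real.cos_sq_add_sin_sq θ
    exact_mod_cast (by nlinarith : Real.cos θ * Real.cos θ + Real.sin θ * Real.sin θ = 1)
  rw [hN2] at hn2
  rw [hsum, hs, mul_one_div_cancel hd]
  linear_combination hn2 + n * n * hcs

theorem recoveryFidelity_superposition (o : A) {θ : ℝ} (hN : 0 < superpositionNorm A θ) :
    recoveryFidelity (marginalAB (superpositionState o θ)) LinearMap.id =
      superpositionFidelity (Fintype.card A) θ := by
  have : Nonempty A := ⟨o⟩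
  have hd : (Fintype.card A : ℝ) ≠ 0 := by simp
  have h : ∀ i j, marginalAB (superpositionState o θ) i j =
      ∑ c, superposition o θ (i.1, i.2, c) * star (superposition o θ (j.1, j.2, c)) :=
    fun i j => rfl
  rw [recoveryFidelity_id_of_sum (ψ := fun c (p : A × A) => superposition o θ (p.1, p.2, c)) h]
  have hsum : ∀ c, ‖∑ a, superposition o θ (a, a, c)‖ ^ 2 = if c = o then
      ((1 / √(superpositionNorm A θ)) * ((1 / √(Fintype.card A : ℝ)) *
        (Fintype.card A * Real.cos θ + Real.sin θ))) ^ 2 else 0 := by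
    intro c
    have : ∑ a, superposition o θ (a, a, c) = if c = o then
      (((1 / √(superpositionNorm A θ)) * ((1 / √(Fintype.card A : ℝ)) *
        (Fintype.card A * Real.cos θ + Real.sin θ)) : ℝ) : ℂ) else 0 := by
      simp only [superposition, maxEntangled, if_true]
      rw [← Finset.mul_sum, Finset.sum_add_distrib, ← Finset.mul_sum, ← Finset.mul_sum]
      simp only [mul_ite, mul_one, mul_zero, Finset.sum_ite_eq', Finset.mem_univ, if_true,
        eq_comm (a := o)]
      split_ifs
      · simp only [Finset.sum_const, Finset.card_univ, nsmul_eq_mul]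
        push_cast
        ring
      · simp
    rw [this]
    split_ifs
    · rw [Complex.norm_real, Real.norm_eq_abs, sq_abs]
    · simp
  simp only [hsum, Finset.sum_ite_eq', Finset.mem_univ, if_true]
  rw [mul_pow, mul_pow, div_pow, div_pow, Real.sq_sqrt hN.le, Real.sq_sqrt (Nat.cast_nonneg _),
    superpositionFidelity]
  have hN' : (Fintype.card A : ℝ) + Real.sin (2 * θ) = Fintype.card A * superpositionNorm A θ := by
    rw [superpositionNorm]; field_simp
  rw [hN']
  have := hN.ne'
  field_simp

theorem superpositionNorm_pos {A : Type*} [Fintype A] [Nonempty A] {θ : ℝ} (hθ : θ ∈ Set.Icc 0 (Real.pi / 2)) :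
    0 < superpositionNorm A θ := by
  obtain ⟨hs, hc⟩ := sin_cos_nonneg_of_mem_Icc hθ
  rw [superpositionNorm, Real.sin_two_mul]
  positivity

theorem recoveryFidelity_superposition_AC (o : A) {θ : ℝ} (hN : 0 < superpositionNorm A θ) :
    recoveryFidelity (marginalAC (superpositionState o θ)) LinearMap.id =
      superpositionFidelity (Fintype.card A) (Real.pi / 2 - θ) := by
  rw [marginalAC_superpositionState, recoveryFidelity_superposition o]
  rwa [superpositionNorm_pi_div_two_sub]

/-- The pair of optima dominates the pair of identity fidelities yet stays in the ellipse, so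
extremality forces both equalities together. -/
theorem Ropt_superposition (o : A) {θ : ℝ} (hθ : θ ∈ Set.Icc 0 (Real.pi / 2)) :
    Ropt (marginalAB (superpositionState o θ)) = superpositionFidelity (Fintype.card A) θ ∧
    Ropt (marginalAC (superpositionState o θ)) =
      superpositionFidelity (Fintype.card A) (Real.pi / 2 - θ) := by
  have : Nonempty A := ⟨o⟩
  have hN := superpositionNorm_pos (A := A) hθ
  have hρ := isState_superpositionState o hN
  have h1 := (recoveryFidelity_id_le_Runitary hρ.marginalAB).trans (Runitary_le_Ropt hρ.marginalAB)
  have h2 := (recoveryFidelity_id_le_Runitary hρ.marginalAC).trans (Runitary_le_Ropt hρ.marginalAC)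
  rw [recoveryFidelity_superposition o hN] at h1
  rw [recoveryFidelity_superposition_AC o hN] at h2
  exact eq_superpositionFidelity_of_ellipse one_le_card_of_nonempty hθ h1 h2
    (Ropt_mem_Icc hρ.marginalAB).2 (Ropt_mem_Icc hρ.marginalAC).2 (Ropt_ellipse hρ)

theorem Runitary_superposition (o : A) {θ : ℝ} (hθ : θ ∈ Set.Icc 0 (Real.pi / 2)) :
    Runitary (marginalAB (superpositionState o θ)) = superpositionFidelity (Fintype.card A) θ ∧
    Runitary (marginalAC (superpositionState o θ)) =
      superpositionFidelity (Fintype.card A) (Real.pi / 2 - θ) := by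
  have : Nonempty A := ⟨o⟩
  have hN := superpositionNorm_pos (A := A) hθ
  have hρ := isState_superpositionState o hN
  obtain ⟨h1, h2⟩ := Ropt_superposition o hθ
  refine ⟨le_antisymm (h1 ▸ Runitary_le_Ropt hρ.marginalAB) ?_,
    le_antisymm (h2 ▸ Runitary_le_Ropt hρ.marginalAC) ?_⟩
  · rw [← recoveryFidelity_superposition o hN]
    exact recoveryFidelity_id_le_Runitary hρ.marginalAB
  · rw [← recoveryFidelity_superposition_AC o hN]
    exact recoveryFidelity_id_le_Runitary hρ.marginalAC

end Superposition

end Monogamy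

end

theorem mainTheorem6 {A : Type*} [Fintype A] [DecidableEq A] (d : ℝ)
    (hd : d = (Fintype.card A : ℝ)) :
    -- the bound, for all tripartite states
    (∀ {B C : Type*} [Fintype B] [Fintype C] (ρ : Matrix (A × B × C) (A × B × C) ℂ),
      Monogamy.IsState ρ →
        d ^ 2 * Monogamy.Ropt (Monogamy.marginalAC ρ) ≤
          (√(Monogamy.Ropt (Monogamy.marginalAB ρ)) +
            √(d ^ 2 - 1) * √(1 - Monogamy.Ropt (Monogamy.marginalAB ρ))) ^ 2) ∧
    -- the superposition is a state, and its fidelities under trivial recovery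
    (∀ (o : A) (θ : ℝ), 0 < Monogamy.superpositionNorm A θ →
      Monogamy.IsState (Monogamy.superpositionState o θ) ∧
      Monogamy.recoveryFidelity (Monogamy.marginalAB (Monogamy.superpositionState o θ))
          LinearMap.id =
        (d * Real.cos θ + Real.sin θ) ^ 2 / (d * (d + Real.sin (2 * θ))) ∧
      Monogamy.recoveryFidelity (Monogamy.marginalAC (Monogamy.superpositionState o θ))
          LinearMap.id =
        (d * Real.sin θ + Real.cos θ) ^ 2 / (d * (d + Real.sin (2 * θ)))) ∧
    -- trivial recovery is optimal for it, and equality holds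
    (∀ (o : A), ∀ θ ∈ Set.Icc 0 (Real.pi / 2),
      0 < Monogamy.superpositionNorm A θ ∧
      Monogamy.Ropt (Monogamy.marginalAB (Monogamy.superpositionState o θ)) =
        Monogamy.recoveryFidelity (Monogamy.marginalAB (Monogamy.superpositionState o θ))
          LinearMap.id ∧
      Monogamy.Ropt (Monogamy.marginalAC (Monogamy.superpositionState o θ)) =
        Monogamy.recoveryFidelity (Monogamy.marginalAC (Monogamy.superpositionState o θ))
          LinearMap.id ∧
      d ^ 2 * Monogamy.Ropt (Monogamy.marginalAC (Monogamy.superpositionState o θ)) =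
        (√(Monogamy.Ropt (Monogamy.marginalAB (Monogamy.superpositionState o θ))) +
          √(d ^ 2 - 1) *
            √(1 - Monogamy.Ropt (Monogamy.marginalAB (Monogamy.superpositionState o θ)))) ^ 2) ∧
    -- equality is attained at every possible value of the optimal fidelity
    (∀ {B : Type*} [Fintype B] (σ : Matrix (A × B) (A × B) ℂ), Monogamy.IsState σ →
      Monogamy.Ropt σ ∈ Set.Icc (1 / d ^ 2) 1) ∧
    (∀ (o : A), ∀ r ∈ Set.Icc (1 / d ^ 2) 1, ∃ θ ∈ Set.Icc 0 (Real.pi / 2),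
      Monogamy.Ropt (Monogamy.marginalAB (Monogamy.superpositionState o θ)) = r) ∧
    -- unitary recovery: the superposition gives the optimal bound
    (∀ ρ : Matrix (A × A × A) (A × A × A) ℂ, Monogamy.IsState ρ →
      d ^ 2 * Monogamy.Runitary (Monogamy.marginalAC ρ) ≤
        (√(Monogamy.Runitary (Monogamy.marginalAB ρ)) +
          √(d ^ 2 - 1) * √(1 - Monogamy.Runitary (Monogamy.marginalAB ρ))) ^ 2 ∧
      Monogamy.Runitary (Monogamy.marginalAB ρ) + Monogamy.Runitary (Monogamy.marginalAC ρ) ≤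
        (d - 1) / d + (√(Monogamy.Runitary (Monogamy.marginalAB ρ)) +
          √(Monogamy.Runitary (Monogamy.marginalAC ρ))) ^ 2 / (d + 1) ∧
      ∃ θ ∈ Set.Icc 0 (Real.pi / 2), ∀ o : A,
        Monogamy.Runitary (Monogamy.marginalAB ρ) ≤
          Monogamy.Runitary (Monogamy.marginalAB (Monogamy.superpositionState o θ)) ∧
        Monogamy.Runitary (Monogamy.marginalAC ρ) ≤
          Monogamy.Runitary (Monogamy.marginalAC (Monogamy.superpositionState o θ))) ∧
    (∀ (o : A), ∀ θ ∈ Set.Icc 0 (Real.pi / 2),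
      Monogamy.Runitary (Monogamy.marginalAB (Monogamy.superpositionState o θ)) =
        Monogamy.Ropt (Monogamy.marginalAB (Monogamy.superpositionState o θ)) ∧
      Monogamy.Runitary (Monogamy.marginalAC (Monogamy.superpositionState o θ)) =
        Monogamy.Ropt (Monogamy.marginalAC (Monogamy.superpositionState o θ))) := by

  subst hd
  refine ⟨?_, ?_, ?_, ?_, ?_, ?_, ?_⟩
  · intro B C _ _ ρ hρ
    have := hρ.nonempty_left
    exact Monogamy.bound_of_ellipse Monogamy.one_le_card_of_nonempty
      (Monogamy.Ropt_nonneg hρ.marginalAB)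
      (Monogamy.Ropt_nonneg hρ.marginalAC) (Monogamy.Ropt_ellipse hρ)
  · intro o θ hN
    refine ⟨Monogamy.isState_superpositionState o hN,
      Monogamy.recoveryFidelity_superposition o hN, ?_⟩
    rw [Monogamy.recoveryFidelity_superposition_AC o hN,
      Monogamy.superpositionFidelity_pi_div_two_sub]
  · intro o θ hθ
    have : Nonempty A := ⟨o⟩
    have hN := Monogamy.superpositionNorm_pos (A := A) hθ
    obtain ⟨h1, h2⟩ := Monogamy.Ropt_superposition o hθ
    rw [h1, h2, Monogamy.recoveryFidelity_superposition o hN,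
      Monogamy.recoveryFidelity_superposition_AC o hN]
    exact ⟨hN, rfl, rfl,
      Monogamy.superpositionFidelity_equality Monogamy.one_le_card_of_nonempty hθ⟩
  · intro B _ σ hσ
    exact Monogamy.Ropt_mem_Icc hσ
  · intro o r hr
    have : Nonempty A := ⟨o⟩
    obtain ⟨θ, hθ, h⟩ :=
      Monogamy.exists_superpositionFidelity_eq Monogamy.one_le_card_of_nonempty hr
    exact ⟨θ, hθ, (Monogamy.Ropt_superposition o hθ).1.trans h⟩
  · intro ρ hρ
    have := hρ.nonempty_left
    have hd : (1 : ℝ) ≤ Fintype.card A := Monogamy.one_le_card_of_nonempty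
    have h := Monogamy.Runitary_ellipse hρ
    obtain ⟨hx0, hx1⟩ := Monogamy.Runitary_mem_Icc hρ.marginalAB
    obtain ⟨hz0, hz1⟩ := Monogamy.Runitary_mem_Icc hρ.marginalAC
    refine ⟨Monogamy.bound_of_ellipse hd hx0 hz0 h,
      Monogamy.sum_bound_of_ellipse hd hx0 hz0 h, ?_⟩
    -- The angle depends only on `d` and the two real fidelities, hence not on `o`.
    obtain ⟨θ, hθ, h1, h2⟩ := Monogamy.exists_le_superpositionFidelity hd hx0 hx1 hz0 hz1 h
    refine ⟨θ, hθ, fun o => ?_⟩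
    obtain ⟨e1, e2⟩ := Monogamy.Runitary_superposition o hθ
    rw [e1, e2]
    exact ⟨h1, h2⟩
  · intro o θ hθ
    obtain ⟨h1, h2⟩ := Monogamy.Ropt_superposition o hθ
    obtain ⟨e1, e2⟩ := Monogamy.Runitary_superposition o hθ
    rw [h1, h2, e1, e2]
    exact ⟨rfl, rfl⟩
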